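/- For a function $T$ that is defined and real-valued for all large $r$, let $$\sigma_2^{\log}(T)=\limsup_{r\to\infty}\frac{\log^+\log^+T(r)}{\log\log r}\in[0,\infty],\qquad \log^+x=\max\{0,\log x\}\ (x>0),\quad \log^+x=0\ (x\le 0),$$ and for a meromorphic function $h$ on $\mathbb C$ let $\sigma_2^{\log}(h)=\sigma_2^{\log}(T(\cdot,h))$, where $T(r,h)$ is the Nevanlinna characteristic of $h$. Let $n\ge 0$ be an integer and let $f:\mathbb C\to\mathbb P^n(\mathbb C)$ be a holomorphic curve, i.e. a holomorphic map. A reduced representation of $f$ is a tuple $\mathbf g=(g_0,\dots,g_n)$ of entire functions without common zeros such that $f(z)=[g_0(z):\dots:g_n(z)]$ for all $z\in\mathbb C$. The characteristic function of $f$ is $$T_f(r)=\frac1{2\pi}\int_0^{2\pi}\log\max_{0\le k\le n}|g_k(re^{i\theta})|\,d\theta,$$ where $\mathbf g$ is a reduced representation of $f$; up to an additive constant it does not depend on the choice of $\mathbf g$. **Theorem 3.5.** If $$\limsup_{r\to\infty}\frac{\log^+\log^+T_f(r)}{\log\log r}<1,$$ then $f$ has a reduced representation $\mathbf f=(f_0,\dots,f_n)$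 such that $\sigma_2^{\log}(f_i)<1$ for every $i=0,\dots,n$. -/

import Mathlib

open Filter Topology
open scoped LinearAlgebra.Projectivization

noncomputable section

/-- The logarithmic hyper-order `limsup_{r → ∞} log⁺ log⁺ T(r) / log log r` of a real function `T`,
as an extended real number (so that an unbounded quotient has hyper-order `⊤`). -/
def logHyperOrder (T : ℝ → ℝ) : EReal :=
  limsup (fun r : ℝ => ((Real.posLog (Real.posLog (T r)) / Real.log (Real.log r) : ℝ) : EReal))
    atTop

/-- The logarithmic hyper-order of a meromorphic function on `ℂ`, computed from its Nevanlinna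
characteristic `T(r, f) = m(r, f) + N(r, f)`. -/
def logHyperOrderFun (f : ℂ → ℂ) : EReal :=
  logHyperOrder (ValueDistribution.characteristic f ⊤)

/-- A map from `ℂ` to complex projective `n`-space is a holomorphic curve if near every point it is
given, in homogeneous coordinates, by a holomorphic map to `ℂ^(n+1)` without zeros. -/
def IsHolomorphicCurve {n : ℕ} (f : ℂ → ℙ ℂ (Fin (n + 1) → ℂ)) : Prop :=
  ∀ z : ℂ, ∃ g : ℂ → Fin (n + 1) → ℂ, AnalyticAt ℂ g z ∧
    ∀ᶠ w in 𝓝 z, ∃ hw : g w ≠ 0, f w = Projectivization.mk ℂ (g w) hw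

/-- `g = (g₀, …, gₙ)` is a reduced representation of `f`: the components are entire functions
without common zeros, and `f(z) = [g₀(z) : … : gₙ(z)]` for every `z`. -/
def IsReducedRepresentation {n : ℕ} (f : ℂ → ℙ ℂ (Fin (n + 1) → ℂ))
    (g : ℂ → Fin (n + 1) → ℂ) : Prop :=
  (∀ i, Differentiable ℂ fun z => g z i) ∧
    ∀ z, ∃ hz : g z ≠ 0, f z = Projectivization.mk ℂ (g z) hz

/-- The mean of `log ‖g‖` over the circle `|z| = r`. The norm of `Fin (n + 1) → ℂ` is the maximum
norm `max_k |g_k|`. -/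
def cartanMean {n : ℕ} (g : ℂ → Fin (n + 1) → ℂ) (r : ℝ) : ℝ :=
  Real.circleAverage (fun z => Real.log ‖g z‖) 0 r

open Classical in
/-- The characteristic function `T_f` of a holomorphic curve: the circle mean of `log ‖g‖` for a
reduced representation `g` of `f`. Another choice of `g` changes it by an additive constant only.
Every holomorphic curve has a reduced representation, so the value `0` is never used for one. -/
def curveCharacteristic {n : ℕ} (f : ℂ → ℙ ℂ (Fin (n + 1) → ℂ)) : ℝ → ℝ :=
  if h : ∃ g, IsReducedRepresentation f g then cartanMean h.choose else 0

end

/-! Write A(r) = exp((log r)^ρ). The hypothesis gives T_f ≤ A for some ρ < 1 and all large r. Take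
any reduced representation g and a component g_i with g_i(0) ≠ 0. By Jensen's formula the counting
function N of the zeros of g_i is at most T_f + O(1) = O(A). Since ρ < 1, A grows slower than any
power, so these zeros carry a genus zero product P, and log|P| ≤ O(A) (`exists_genus_zero_product`):
∑ log(1 + r/|z|) is bounded by a multiple of ∑ 2^(-k) N(2^k r), while A(2^k r) ≤ A(2^k) A(r) and ∑
2^(-k) A(2^k) < ∞.

Now P = u g_i with u entire and zero-free, so G = u g is a reduced representation with G_i = P, and
its mean differs from T_f by a constant. As x⁺ - x is decreasing in x, log⁺|G_j| ≤ log‖G‖ + log⁺|P|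
- log|P|. Averaging, with Jensen for P, gives T(r, G_j) = O(A) for all j
(`IsReducedRepresentation.characteristic_apply_le`).

That some g exists at all follows by gluing local representations with Weierstrass' theorem. -/

/-! ### Infinite products of entire functions -/

/-- The family of functions `F` converges to `1` absolutely and uniformly on bounded sets. -/
def NormallyConvergesToOne {ι : Type*} (F : ι → ℂ → ℂ) : Prop :=
  ∀ R : ℝ, ∃ u : ι → ℝ, Summable u ∧ ∀ᶠ i in cofinite, ∀ w, ‖w‖ ≤ R → ‖F i w - 1‖ ≤ u i

namespace NormallyConvergesToOne

variable {ι : Type*} {F : ι → ℂ → ℂ}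

lemma summable_norm_sub_one (hF : NormallyConvergesToOne F) (w : ℂ) :
    Summable fun i => ‖F i w - 1‖ := by
  obtain ⟨u, hu, hb⟩ := hF ‖w‖
  refine hu.of_norm_bounded_eventually ?_
  filter_upwards [hb] with i hi
  simpa using hi w le_rfl

lemma multipliable (hF : NormallyConvergesToOne F) (w : ℂ) : Multipliable fun i => F i w := by
  simpa using multipliable_one_add_of_summable (hF.summable_norm_sub_one w)

lemma tprod_ne_zero (hF : NormallyConvergesToOne F) {w : ℂ} (h : ∀ i, F i w ≠ 0) :
    ∏' i, F i w ≠ 0 := by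
  simpa using tprod_one_add_ne_zero_of_summable (f := fun i => F i w - 1) (by simpa using h)
    (hF.summable_norm_sub_one w)

lemma differentiable_tprod (hF : NormallyConvergesToOne F) (hd : ∀ i, Differentiable ℂ (F i)) :
    Differentiable ℂ fun w => ∏' i, F i w := by
  intro w
  obtain ⟨u, hu, hb⟩ := hF (‖w‖ + 1)
  have h := hu.hasProdLocallyUniformlyOn_one_add (f := fun i w => F i w - 1)
    (K := Metric.ball (0 : ℂ) (‖w‖ + 1)) Metric.isOpen_ball
    (by
      filter_upwards [hb] with i hi x hx
      exact hi x (by simpa using (mem_ball_zero_iff.1 hx).le))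
    (fun i => ((hd i).continuous.sub continuous_const).continuousOn)
  simp only [add_sub_cancel] at h
  rw [hasProdLocallyUniformlyOn_iff_tendstoLocallyUniformlyOn] at h
  have h2 := h.differentiableOn (Eventually.of_forall fun s =>
    (DifferentiableOn.fun_finsetProd fun i _ => (hd i).differentiableOn)) Metric.isOpen_ball
  exact h2.differentiableAt (Metric.isOpen_ball.mem_nhds (by simp))

/-- Used to split off the one factor that vanishes at a given point. -/
lemma ite_one [DecidableEq ι] (hF : NormallyConvergesToOne F) (a : ι) :
    NormallyConvergesToOne fun i => if i = a then fun _ => 1 else F i := by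
  intro R
  obtain ⟨u, hu, hb⟩ := hF R
  refine ⟨u, hu, ?_⟩
  filter_upwards [hb, (Set.finite_singleton a).compl_mem_cofinite] with i hi hia w hw
  rw [if_neg (by simpa using hia)]
  exact hi w hw

lemma tprod_eq_mul_tprod_ite [DecidableEq ι] (hF : NormallyConvergesToOne F) (a : ι) (w : ℂ) :
    ∏' i, F i w = F a w * ∏' i, (if i = a then fun _ => 1 else F i : ℂ → ℂ) w := by
  rw [Multipliable.tprod_eq_mul_tprod_ite' a]
  · congr 1
    refine tprod_congr fun i => ?_
    split_ifs <;> rfl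
  · refine ((hF.ite_one a).multipliable w).congr fun i => ?_
    by_cases h : i = a
    · subst h; simp
    · simp [h]

end NormallyConvergesToOne

/-! ### Weierstrass products -/

namespace Complex

/-- The Weierstrass elementary factor `(1 - u) exp (u + u² / 2 + ⋯ + uᵖ / p)`. -/
noncomputable def elementaryFactor (p : ℕ) (u : ℂ) : ℂ :=
  (1 - u) * exp (-logTaylor (p + 1) (-u))

lemma differentiable_elementaryFactor (p : ℕ) : Differentiable ℂ (elementaryFactor p) := by
  have : Differentiable ℂ (logTaylor (p + 1)) := fun z =>
    (hasDerivAt_logTaylor p z).differentiableAt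
  unfold elementaryFactor
  exact (by fun_prop : Differentiable ℂ fun u : ℂ => 1 - u).mul
    ((this.comp differentiable_neg).neg.cexp)

@[simp] lemma elementaryFactor_apply_zero (p : ℕ) : elementaryFactor p 0 = 1 := by
  simp [elementaryFactor, logTaylor_at_zero]

lemma elementaryFactor_zero (u : ℂ) : elementaryFactor 0 u = 1 - u := by
  simp [elementaryFactor, logTaylor_succ, logTaylor_zero]

lemma elementaryFactor_eq_zero_iff {p : ℕ} {u : ℂ} : elementaryFactor p u = 0 ↔ u = 1 := by
  rw [elementaryFactor, mul_eq_zero, or_iff_left (exp_ne_zero _), sub_eq_zero, eq_comm]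

/-- The factor is exp L, where L is the tail of the series of log(1 - u), of size at most
2‖u‖^(p+1). The m-th power is exp(mL), and ‖exp x - 1‖ ≤ 2‖x‖ for ‖x‖ ≤ 1. -/
lemma norm_elementaryFactor_pow_sub_one_le {p m : ℕ} {u : ℂ} (hu : ‖u‖ ≤ 1 / 2)
    (hm : m * ‖u‖ ^ (p + 1) ≤ 1 / 2) :
    ‖elementaryFactor p u ^ m - 1‖ ≤ 4 * (m * ‖u‖ ^ (p + 1)) := by
  have hne : (1 : ℂ) - u ≠ 0 := by
    intro h
    rw [← sub_eq_zero.1 h, norm_one] at hu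
    norm_num at hu
  set L := log (1 + -u) - logTaylor (p + 1) (-u) with hL
  have hE : elementaryFactor p u = exp L := by
    rw [hL, sub_eq_add_neg (log _), exp_add, ← sub_eq_add_neg, exp_log hne, elementaryFactor]
  have hLn : ‖L‖ ≤ 2 * ‖u‖ ^ (p + 1) := by
    have h1 := norm_log_sub_logTaylor_le p (z := -u) (by rw [norm_neg]; linarith)
    rw [norm_neg] at h1
    refine h1.trans ?_
    have h2 : (1 - ‖u‖)⁻¹ ≤ 2 := by
      rw [inv_le_comm₀ (by linarith) (by norm_num)]; linarith
    calc ‖u‖ ^ (p + 1) * (1 - ‖u‖)⁻¹ / (p + 1) ≤ ‖u‖ ^ (p + 1) * (1 - ‖u‖)⁻¹ :=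
          div_le_self (mul_nonneg (by positivity) (inv_nonneg.2 (by linarith)))
            (by linarith [Nat.cast_nonneg (α := ℝ) p])
      _ ≤ ‖u‖ ^ (p + 1) * 2 := by gcongr
      _ = _ := by ring
  have hmL : ‖(m : ℂ) * L‖ ≤ 2 * (m * ‖u‖ ^ (p + 1)) := by
    rw [norm_mul, norm_natCast]
    calc (m : ℝ) * ‖L‖ ≤ m * (2 * ‖u‖ ^ (p + 1)) := by gcongr
      _ = _ := by ring
  rw [hE, ← exp_nat_mul]
  have := norm_exp_sub_one_le (x := (m : ℂ) * L) (by linarith)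
  linarith

end Complex

open Complex

/-- The Weierstrass product with zeros of multiplicity `m z` at `z` and genus `p z` of the
factor belonging to `z`. -/
noncomputable def weierstrassProduct (m p : ℂ → ℕ) (w : ℂ) : ℂ :=
  w ^ m 0 * ∏' z, elementaryFactor (p z) (w / z) ^ m z

section weierstrassProduct

variable {m p : ℂ → ℕ}

lemma normallyConvergesToOne_elementaryFactor
    (hfin : ∀ R : ℝ, {z | ‖z‖ ≤ R ∧ m z ≠ 0}.Finite)
    (hsum : ∀ R : ℝ, 0 ≤ R → Summable fun z : ℂ => m z * (R / ‖z‖) ^ (p z + 1)) :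
    NormallyConvergesToOne fun z w => elementaryFactor (p z) (w / z) ^ m z := by
  intro R
  have hs := hsum |R| (abs_nonneg R)
  refine ⟨_, hs.mul_left 4, ?_⟩
  filter_upwards [hs.tendsto_cofinite_zero.eventually_le_const (show (0 : ℝ) < 1 / 2 by norm_num),
    (hfin (2 * |R|)).compl_mem_cofinite] with z hz hzR w hw
  have hwR : ‖w‖ ≤ |R| := hw.trans (le_abs_self R)
  by_cases hm : m z = 0
  · simp [hm]
  have hzR' : 2 * |R| < ‖z‖ := by
    by_contra! h
    exact hzR ⟨h, hm⟩
  have hz0 : 0 < ‖z‖ := lt_of_le_of_lt (by positivity) hzR'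
  have hle : (m z : ℝ) * ‖w / z‖ ^ (p z + 1) ≤ m z * (|R| / ‖z‖) ^ (p z + 1) := by
    rw [norm_div]; gcongr
  refine (norm_elementaryFactor_pow_sub_one_le ?_ (hle.trans hz)).trans (by gcongr)
  rw [norm_div, div_le_iff₀ hz0]
  linarith

lemma differentiable_weierstrassProduct
    (hF : NormallyConvergesToOne fun z w => elementaryFactor (p z) (w / z) ^ m z) :
    Differentiable ℂ (weierstrassProduct m p) := by
  unfold weierstrassProduct
  refine (differentiable_pow _).mul (hF.differentiable_tprod fun z => ?_)
  exact ((differentiable_elementaryFactor (p z)).comp (differentiable_id.div_const z)).pow _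

/-- Only the factor belonging to `a` vanishes at `a`; the product `Q` of the others does not. -/
lemma analyticOrderAt_weierstrassProduct
    (hF : NormallyConvergesToOne fun z w => elementaryFactor (p z) (w / z) ^ m z) (a : ℂ) :
    analyticOrderAt (weierstrassProduct m p) a = m a := by
  classical
  have hdE (z : ℂ) : Differentiable ℂ fun w => elementaryFactor (p z) (w / z) ^ m z :=
    ((differentiable_elementaryFactor (p z)).comp (differentiable_id.div_const z)).pow _
  rw [(differentiable_weierstrassProduct hF).analyticAt a |>.analyticOrderAt_eq_natCast]
  set Q : ℂ → ℂ := fun w => ∏' z, (if z = a then fun _ => 1 else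
    fun w => elementaryFactor (p z) (w / z) ^ m z : ℂ → ℂ) w with hQ
  have hQd : Differentiable ℂ Q := (hF.ite_one a).differentiable_tprod fun z => by
    split_ifs
    · exact differentiable_const 1
    · exact hdE z
  have hQa : Q a ≠ 0 := (hF.ite_one a).tprod_ne_zero fun z => by
    split_ifs with h
    · exact one_ne_zero
    · refine pow_ne_zero _ fun h0 => h ?_
      rw [elementaryFactor_eq_zero_iff] at h0
      by_cases hz : z = 0
      · simp [hz] at h0
      · rw [div_eq_one_iff_eq hz] at h0
        exact h0.symm
  have hP (w : ℂ) : weierstrassProduct m p w =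
      w ^ m 0 * (elementaryFactor (p a) (w / a) ^ m a * Q w) := by
    rw [weierstrassProduct, hF.tprod_eq_mul_tprod_ite a]
  -- Since `w / 0 = 0`, the factor belonging to the origin is 1, and the zero there comes from `w ^
  -- m 0` alone.
  by_cases ha : a = 0
  · subst ha
    exact ⟨Q, hQd.analyticAt 0, hQa, Eventually.of_forall fun w => by simp [hP]⟩
  · have hlog : Differentiable ℂ (logTaylor (p a + 1)) := fun z =>
      (hasDerivAt_logTaylor (p a) z).differentiableAt
    refine ⟨fun w => w ^ m 0 * (((-1 / a) * exp (-logTaylor (p a + 1) (-(w / a)))) ^ m a * Q w),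
      Differentiable.analyticAt ?_ a, ?_, Eventually.of_forall fun w => ?_⟩
    · refine (differentiable_pow _).mul (Differentiable.mul (Differentiable.pow ?_ _) hQd)
      exact (hlog.comp (differentiable_id.div_const a).neg).neg.cexp.const_mul _
    · have hE := exp_ne_zero (-logTaylor (p a + 1) (-(a / a)))
      have ha' : -1 / a ≠ 0 := div_ne_zero (by simp) ha
      exact mul_ne_zero (pow_ne_zero _ ha) (mul_ne_zero (pow_ne_zero _ (mul_ne_zero ha' hE)) hQa)
    · have h1 : 1 - w / a = (w - a) * (-1 / a) := by field_simp; ring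
      rw [hP, elementaryFactor, h1, mul_assoc (w - a), mul_pow (w - a), smul_eq_mul]
      ring

/-- **Weierstrass' theorem**: every locally finite multiplicity function is the order function
of an entire function. -/
theorem exists_differentiable_analyticOrderAt_eq
    (hfin : ∀ R : ℝ, {z | ‖z‖ ≤ R ∧ m z ≠ 0}.Finite) :
    ∃ P : ℂ → ℂ, Differentiable ℂ P ∧ ∀ z, analyticOrderAt P z = m z := by
  have hc : {z | m z ≠ 0}.Countable := by
    have : {z | m z ≠ 0} = ⋃ n : ℕ, {z | ‖z‖ ≤ n ∧ m z ≠ 0} := by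
      ext z
      simp only [Set.mem_ofPred_eq, Set.mem_iUnion, exists_and_right]
      exact ⟨fun h => ⟨exists_nat_ge ‖z‖, h⟩, fun h => h.2⟩
    rw [this]
    exact Set.countable_iUnion fun n => (hfin n).countable
  obtain ⟨e, he⟩ := Set.countable_iff_exists_injOn.1 hc
  -- In the genus, the summand `m z` beats the multiplicity through m ≤ 2^m, and the injective
  -- numbering `e z` leaves a geometric series.
  have hF : NormallyConvergesToOne fun z w =>
      elementaryFactor (m z + e z) (w / z) ^ m z := by
    refine normallyConvergesToOne_elementaryFactor hfin fun R hR => ?_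
    have hgeo : Summable fun z : {z | m z ≠ 0} => (1 / 2 : ℝ) ^ e z :=
      summable_geometric_two.comp_injective he.injective
    have hgeo' : Summable ({z | m z ≠ 0}.indicator fun z => (1 / 2 : ℝ) ^ e z) :=
      summable_subtype_iff_indicator.1 hgeo
    refine hgeo'.of_norm_bounded_eventually ?_
    filter_upwards [(hfin (2 * R)).compl_mem_cofinite] with z hz
    by_cases hm : m z = 0
    · simp [hm]
    have hzR : 2 * R < ‖z‖ := by
      by_contra! h
      exact hz ⟨h, hm⟩
    have hz0 : 0 < ‖z‖ := lt_of_le_of_lt (by positivity) hzR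
    rw [Set.indicator_of_mem (by exact hm), Real.norm_of_nonneg (by positivity)]
    have h1 : R / ‖z‖ ≤ 1 / 2 := by
      rw [div_le_iff₀ hz0]; linarith
    have h2 : (m z : ℝ) ≤ 2 ^ m z := by exact_mod_cast Nat.lt_two_pow_self.le
    calc (m z : ℝ) * (R / ‖z‖) ^ (m z + e z + 1)
        ≤ 2 ^ m z * (1 / 2) ^ (m z + e z + 1) := by gcongr
      _ = (1 / 2) ^ (e z) * (1 / 2) * (2 ^ m z * (1 / 2) ^ m z) := by ring
      _ = (1 / 2) ^ (e z) * (1 / 2) := by rw [← mul_pow]; norm_num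
      _ ≤ (1 / 2) ^ (e z) := mul_le_of_le_one_right (by positivity) (by norm_num)
  exact ⟨_, differentiable_weierstrassProduct hF, analyticOrderAt_weierstrassProduct hF⟩

/-- A canonical product of genus zero with prescribed multiplicities away from the origin. -/
theorem exists_differentiable_analyticOrderAt_eq_norm_le (hm0 : m 0 = 0)
    (hfin : ∀ R : ℝ, {z | ‖z‖ ≤ R ∧ m z ≠ 0}.Finite)
    (hsum : Summable fun z : ℂ => m z / ‖z‖) :
    ∃ P : ℂ → ℂ, Differentiable ℂ P ∧ (∀ z, analyticOrderAt P z = m z) ∧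
      ∀ (w : ℂ) (B : ℝ), (∀ s : Finset ℂ, ∑ z ∈ s, m z * Real.log (1 + ‖w‖ / ‖z‖) ≤ B) →
        ‖P w‖ ≤ Real.exp B := by
  have hF : NormallyConvergesToOne fun z w => elementaryFactor 0 (w / z) ^ m z := by
    refine normallyConvergesToOne_elementaryFactor (p := fun _ => 0) hfin fun R _ => ?_
    refine (hsum.mul_left R).congr fun z => ?_
    ring
  refine ⟨weierstrassProduct m fun _ => 0, differentiable_weierstrassProduct hF,
    analyticOrderAt_weierstrassProduct hF, fun w B hB => ?_⟩
  rw [weierstrassProduct, hm0, pow_zero, one_mul]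
  refine le_of_tendsto ((hF.multipliable w).hasProd.norm) (Eventually.of_forall fun s => ?_)
  have hpos (z : ℂ) : 0 < 1 + ‖w‖ / ‖z‖ := by positivity
  calc ∏ z ∈ s, ‖elementaryFactor 0 (w / z) ^ m z‖
      = ∏ z ∈ s, ‖1 - w / z‖ ^ m z := by simp [elementaryFactor_zero]
    _ ≤ ∏ z ∈ s, (1 + ‖w‖ / ‖z‖) ^ m z := by
        gcongr with z
        simpa using norm_sub_le 1 (w / z)
    _ = Real.exp (∑ z ∈ s, m z * Real.log (1 + ‖w‖ / ‖z‖)) := by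
        rw [Real.exp_sum]
        refine Finset.prod_congr rfl fun z _ => ?_
        rw [Real.exp_nat_mul, Real.exp_log (hpos z)]
    _ ≤ Real.exp B := Real.exp_le_exp.2 (hB s)

end weierstrassProduct

/-! ### Functions of logarithmic hyper-order less than one -/

/-- The comparison function `exp ((log r) ^ ρ)`. -/
noncomputable def expLogPow (ρ r : ℝ) : ℝ := Real.exp (Real.log r ^ ρ)

lemma one_le_expLogPow {ρ r : ℝ} (hr : 1 ≤ r) : 1 ≤ expLogPow ρ r :=
  Real.one_le_exp (Real.rpow_nonneg (Real.log_nonneg hr) ρ)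

/-- This is subadditivity of t ↦ t^ρ, applied to logarithms. -/
lemma expLogPow_mul_le {ρ r s : ℝ} (h0 : 0 ≤ ρ) (h1 : ρ ≤ 1) (hr : 1 ≤ r) (hs : 1 ≤ s) :
    expLogPow ρ (r * s) ≤ expLogPow ρ r * expLogPow ρ s := by
  rw [expLogPow, expLogPow, expLogPow, ← Real.exp_add, Real.exp_le_exp,
    Real.log_mul (by positivity) (by positivity)]
  exact Real.rpow_add_le_add_rpow (Real.log_nonneg hr) (Real.log_nonneg hs) h0 h1

lemma isLittleO_rpow_rpow_atTop {p q : ℝ} (h : p < q) :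
    (fun x : ℝ => x ^ p) =o[atTop] fun x : ℝ => x ^ q := by
  refine Asymptotics.isLittleO_of_tendsto' ?_ ?_
  · filter_upwards [eventually_gt_atTop 0] with x hx h0
    exact absurd h0 (Real.rpow_pos_of_pos hx q).ne'
  · refine (tendsto_rpow_neg_atTop (sub_pos.2 h)).congr' ?_
    filter_upwards [eventually_gt_atTop 0] with x hx
    rw [← Real.rpow_sub hx, neg_sub]

/-- With x = k log 2 the term is exp(x^ρ - x), eventually at most exp(-x/2) because ρ < 1. -/
lemma summable_expLogPow_two_pow {ρ : ℝ} (h1 : ρ < 1) :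
    Summable fun k : ℕ => (1 / 2 : ℝ) ^ k * expLogPow ρ (2 ^ k) := by
  have hg : Summable fun k : ℕ => (Real.exp (-(Real.log 2 / 2))) ^ k :=
    summable_geometric_of_lt_one (Real.exp_pos _).le
      (Real.exp_lt_one_iff.2 (by have := Real.log_pos one_lt_two; linarith))
  refine hg.of_norm_bounded_eventually_nat ?_
  have hlo := (isLittleO_rpow_rpow_atTop h1).bound (show (0 : ℝ) < 1 / 2 by norm_num)
  have htend : Tendsto (fun k : ℕ => (k : ℝ) * Real.log 2) atTop atTop :=
    tendsto_natCast_atTop_atTop.atTop_mul_const (Real.log_pos one_lt_two)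
  filter_upwards [htend.eventually hlo] with k hk
  have hk0 : 0 ≤ (k : ℝ) * Real.log 2 := mul_nonneg k.cast_nonneg (Real.log_pos one_lt_two).le
  rw [Real.rpow_one, Real.norm_of_nonneg (Real.rpow_nonneg hk0 ρ), Real.norm_of_nonneg hk0] at hk
  have h2 : (1 / 2 : ℝ) ^ k = Real.exp (-(k * Real.log 2)) := by
    rw [Real.exp_neg, Real.exp_nat_mul, Real.exp_log two_pos, one_div, inv_pow]
  have hp : 0 < expLogPow ρ (2 ^ k) := Real.exp_pos _
  rw [Real.norm_of_nonneg (by positivity), h2, expLogPow, Real.log_pow, ← Real.exp_add,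
    ← Real.exp_nat_mul, Real.exp_le_exp]
  linarith

lemma exists_eventually_le_expLogPow {T : ℝ → ℝ} (hT : logHyperOrder T < 1) :
    ∃ ρ : ℝ, 0 < ρ ∧ ρ < 1 ∧ ∀ᶠ r in atTop, T r ≤ expLogPow ρ r := by
  obtain ⟨q, hTq, hq1⟩ := EReal.lt_iff_exists_real_btwn.1 hT
  have hq1' : q < 1 := by exact_mod_cast hq1
  -- `q` is not known to be positive; the maximum with 1/2 is.
  refine ⟨max q (1 / 2), lt_of_lt_of_le (by norm_num) (le_max_right _ _),
    max_lt hq1' (by norm_num), ?_⟩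
  have h := eventually_lt_of_limsup_lt hTq
  have hloglog : Tendsto (fun r => Real.log (Real.log r)) atTop atTop :=
    Real.tendsto_log_atTop.comp Real.tendsto_log_atTop
  filter_upwards [h, hloglog.eventually_gt_atTop 0,
    Real.tendsto_log_atTop.eventually_gt_atTop 0] with r hr hll hl
  rw [EReal.coe_lt_coe_iff, div_lt_iff₀ hll] at hr
  have h1 : Real.log (Real.posLog (T r)) ≤ max q (1 / 2) * Real.log (Real.log r) :=
    (le_max_right _ _).trans (hr.le.trans (by gcongr; exact le_max_left _ _))
  have h2 : Real.posLog (T r) ≤ Real.log r ^ max q (1 / 2) := by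
    rcases Real.posLog_nonneg.eq_or_lt with h0 | h0
    · rw [← h0]; exact Real.rpow_nonneg hl.le _
    · rw [Real.rpow_def_of_pos hl, mul_comm (Real.log _)]
      exact (Real.log_le_iff_le_exp h0).1 h1
  rcases le_or_gt (T r) 0 with h0 | h0
  · exact h0.trans (Real.exp_pos _).le
  · exact (Real.log_le_iff_le_exp h0).1 ((le_max_right _ _).trans h2)

/-- An exponent q strictly between ρ and 1 absorbs the constant: log C and (log r)^ρ are each
eventually at most half of (log r)^q. -/
lemma logHyperOrder_lt_one_of_le {T : ℝ → ℝ} {ρ C : ℝ} (h0 : 0 < ρ) (h1 : ρ < 1)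
    (hT0 : ∀ᶠ r in atTop, 0 ≤ T r) (hT : ∀ᶠ r in atTop, T r ≤ C * expLogPow ρ r) :
    logHyperOrder T < 1 := by
  obtain ⟨q, hρq, hq1⟩ := exists_between h1
  have hq0 : 0 < q := h0.trans hρq
  refine lt_of_le_of_lt (b := (q : EReal)) ?_ (by exact_mod_cast hq1)
  refine limsup_le_of_le (by isBoundedDefault) ?_
  have hloglog : Tendsto (fun r => Real.log (Real.log r)) atTop atTop :=
    Real.tendsto_log_atTop.comp Real.tendsto_log_atTop
  set D := max C 1 with hD
  have hD1 : 1 ≤ D := le_max_right _ _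
  have hlo := Real.tendsto_log_atTop.eventually
    ((isLittleO_rpow_rpow_atTop hρq).bound (show (0 : ℝ) < 1 / 2 by norm_num))
  have hlarge := ((tendsto_rpow_atTop hq0).comp Real.tendsto_log_atTop).eventually_ge_atTop
    (2 * Real.log D)
  filter_upwards [hT0, hT, hloglog.eventually_gt_atTop 0,
    Real.tendsto_log_atTop.eventually_ge_atTop 1, hlo, hlarge] with r hr0 hr hll hl hlo hlarge
  have hl0 : 0 < Real.log r := by linarith
  rw [Real.norm_of_nonneg (by positivity), Real.norm_of_nonneg (by positivity)] at hlo
  simp only [Function.comp_apply] at hlarge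
  have hq1 : 1 ≤ Real.log r ^ q := Real.one_le_rpow hl hq0.le
  have h2 : Real.posLog (T r) ≤ Real.log r ^ q := by
    refine max_le (by positivity) ?_
    rcases hr0.eq_or_lt with h | h
    · rw [← h, Real.log_zero]; positivity
    · have hTD : T r ≤ D * expLogPow ρ r :=
        hr.trans (mul_le_mul_of_nonneg_right (le_max_left _ _) (Real.exp_pos _).le)
      have h3 := Real.log_le_log h hTD
      rw [expLogPow, Real.log_mul (by positivity) (Real.exp_pos _).ne', Real.log_exp] at h3
      linarith
  have h3 : Real.posLog (Real.posLog (T r)) ≤ q * Real.log (Real.log r) := by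
    refine max_le (by positivity) ?_
    rw [← Real.log_rpow hl0]
    rcases (Real.posLog_nonneg (x := T r)).eq_or_lt with h | h
    · rw [← h, Real.log_zero]; exact Real.log_nonneg hq1
    · exact Real.log_le_log h h2
  rw [EReal.coe_le_coe_iff, div_le_iff₀ hll]
  exact h3

/-! ### Comparing a genus zero product with the counting function of its zeros -/

lemma exists_nat_one_lt_two_pow_mul_le_two {x : ℝ} (hx0 : 0 < x) (hx : x ≤ 1) :
    ∃ k : ℕ, 1 < 2 ^ k * x ∧ 2 ^ k * x ≤ 2 := by
  obtain ⟨n, hn1, hn2⟩ := exists_nat_pow_near (one_le_inv_iff₀.2 ⟨hx0, hx⟩) one_lt_two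
  refine ⟨n + 1, ?_, ?_⟩
  · rw [inv_lt_iff_one_lt_mul₀ hx0] at hn2
    linarith
  · rw [pow_succ, mul_right_comm]
    have : (2 : ℝ) ^ n * x ≤ 1 := by
      rwa [le_inv_comm₀ (by positivity) hx0, ← one_div, le_div_iff₀ (by positivity), mul_comm]
        at hn1
    linarith

/-- For every `x` there is a dyadic dilation controlling `log (1 + x)`. -/
lemma exists_log_one_add_le_posLog {x : ℝ} (hx0 : 0 < x) :
    ∃ k : ℕ, Real.log (1 + x) ≤ 4 / Real.log 2 * ((1 / 2) ^ k * Real.posLog (2 ^ k * x)) := by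
  have hl2 : 0 < Real.log 2 := Real.log_pos one_lt_two
  have hl2' : Real.log 2 < 1 := by linarith [Real.log_two_lt_d9]
  rcases le_or_gt x 1 with hx | hx
  · obtain ⟨k, hk1, hk2⟩ := exists_nat_one_lt_two_pow_mul_le_two hx0 hx
    -- One further doubling pushes the argument beyond 2, so that log⁺ is at least log 2 and not
    -- merely positive.
    refine ⟨k + 1, ?_⟩
    have h1 : Real.log 2 ≤ Real.posLog (2 ^ (k + 1) * x) := by
      refine le_trans ?_ (le_max_right _ _)
      refine Real.log_le_log two_pos ?_
      rw [pow_succ]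
      linarith
    have h2 : x ≤ 2 * (1 / 2) ^ k := by
      rw [one_div, inv_pow, ← div_eq_mul_inv, le_div_iff₀ (by positivity)]
      linarith
    calc Real.log (1 + x) ≤ x := by
          have := Real.log_le_sub_one_of_pos (show 0 < 1 + x by positivity)
          linarith
      _ ≤ 2 * (1 / 2) ^ k := h2
      _ = 4 / Real.log 2 * ((1 / 2) ^ (k + 1) * Real.log 2) := by field_simp; ring
      _ ≤ _ := by gcongr
  · refine ⟨1, ?_⟩
    have h1 : Real.log (1 + x) ≤ Real.posLog (2 ^ 1 * x) :=
      (Real.log_le_log (by positivity) (by linarith)).trans (le_max_right _ _)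
    refine h1.trans ?_
    rw [← mul_assoc]
    refine le_mul_of_one_le_left Real.posLog_nonneg ?_
    rw [div_mul_eq_mul_div, le_div_iff₀ hl2]
    linarith

/-- Each zero needs only one dyadic scale; bounding that term by the series over all scales allows
the two sums to be exchanged. -/
lemma sum_mul_log_one_add_le {m : ℂ → ℕ} {A : ℝ} {b : ℕ → ℝ} (r : ℝ) (hr : 0 < r)
    (hb : Summable fun k => (1 / 2 : ℝ) ^ k * b k)
    (h : ∀ (k : ℕ) (s : Finset ℂ),
      ∑ z ∈ s, m z * Real.posLog (2 ^ k * r / ‖z‖) ≤ A * b k) (s : Finset ℂ) :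
    ∑ z ∈ s, m z * Real.log (1 + r / ‖z‖) ≤
      4 / Real.log 2 * (A * ∑' k, (1 / 2 : ℝ) ^ k * b k) := by
  have hl2 : 0 < Real.log 2 := Real.log_pos one_lt_two
  have hterm (k : ℕ) : ∑ z ∈ s, (1 / 2 : ℝ) ^ k * (m z * Real.posLog (2 ^ k * r / ‖z‖)) ≤
      A * ((1 / 2 : ℝ) ^ k * b k) := by
    rw [← Finset.mul_sum]
    calc _ ≤ (1 / 2 : ℝ) ^ k * (A * b k) := by gcongr; exact h k s
      _ = _ := by ring
  have hnn (k : ℕ) (z : ℂ) : 0 ≤ (1 / 2 : ℝ) ^ k * (m z * Real.posLog (2 ^ k * r / ‖z‖)) := by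
    have := Real.posLog_nonneg (x := 2 ^ k * r / ‖z‖)
    positivity
  have hsum : Summable fun k : ℕ =>
      ∑ z ∈ s, (1 / 2 : ℝ) ^ k * (m z * Real.posLog (2 ^ k * r / ‖z‖)) :=
    Summable.of_nonneg_of_le (fun k => Finset.sum_nonneg fun z _ => hnn k z) hterm (hb.mul_left A)
  have hsumz (z : ℂ) (hz : z ∈ s) : Summable fun k : ℕ =>
      (1 / 2 : ℝ) ^ k * (m z * Real.posLog (2 ^ k * r / ‖z‖)) :=
    Summable.of_nonneg_of_le (fun k => hnn k z)
      (fun k => Finset.single_le_sum (fun z _ => hnn k z) hz) hsum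
  calc ∑ z ∈ s, m z * Real.log (1 + r / ‖z‖)
      ≤ ∑ z ∈ s, 4 / Real.log 2 *
        ∑' k : ℕ, (1 / 2 : ℝ) ^ k * (m z * Real.posLog (2 ^ k * r / ‖z‖)) := by
        refine Finset.sum_le_sum fun z hz => ?_
        rcases eq_or_ne z 0 with rfl | hz0
        · simp
        obtain ⟨k, hk⟩ := exists_log_one_add_le_posLog (x := r / ‖z‖) (by positivity)
        calc m z * Real.log (1 + r / ‖z‖)
            ≤ m z * (4 / Real.log 2 * ((1 / 2) ^ k * Real.posLog (2 ^ k * (r / ‖z‖)))) := by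
              gcongr
          _ = 4 / Real.log 2 * ((1 / 2 : ℝ) ^ k * (m z * Real.posLog (2 ^ k * r / ‖z‖))) := by
              rw [mul_div_assoc]; ring
          _ ≤ _ := by
              gcongr
              exact (hsumz z hz).le_tsum k fun j _ => hnn j z
    _ = 4 / Real.log 2 *
        ∑' k : ℕ, ∑ z ∈ s, (1 / 2 : ℝ) ^ k * (m z * Real.posLog (2 ^ k * r / ‖z‖)) := by
        rw [← Finset.mul_sum, Summable.tsum_finsetSum hsumz]
    _ ≤ 4 / Real.log 2 * ∑' k : ℕ, A * ((1 / 2 : ℝ) ^ k * b k) := by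
        refine mul_le_mul_of_nonneg_left ?_ (by positivity)
        exact Summable.tsum_le_tsum hterm hsum (hb.mul_left A)
    _ = _ := by rw [tsum_mul_left]

/-! ### Existence of reduced representations -/

lemma finite_norm_le_ne_zero_of_eventually {m : ℂ → ℕ} (h : ∀ z, ∀ᶠ w in 𝓝[≠] z, m w = 0)
    (R : ℝ) : {z | ‖z‖ ≤ R ∧ m z ≠ 0}.Finite := by
  have key : (Metric.closedBall (0 : ℂ) R ∩ {z | m z ≠ 0}).Finite := by
    refine (isCompact_closedBall (0 : ℂ) R).induction_on
      (p := fun s => (s ∩ {z | m z ≠ 0}).Finite) (by simp) ?_ ?_ ?_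
    · exact fun s t hst ht => ht.subset (Set.inter_subset_inter_left _ hst)
    · intro s t hs ht
      rw [Set.union_inter_distrib_right]
      exact hs.union ht
    · intro z _
      have hz := eventually_nhdsWithin_iff.1 (h z)
      refine ⟨_, mem_nhdsWithin_of_mem_nhds hz, (Set.finite_singleton z).subset ?_⟩
      rintro w ⟨hw, hmw⟩
      by_contra hne
      exact hmw (hw hne)
  refine key.subset fun z hz => ⟨by simpa using hz.1, hz.2⟩

lemma AnalyticAt.exists_eventuallyEq_mul_of_analyticOrderAt_eq {P f : ℂ → ℂ} {z : ℂ}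
    (hP : AnalyticAt ℂ P z) (hf : AnalyticAt ℂ f z)
    (hord : analyticOrderAt P z = analyticOrderAt f z) (htop : analyticOrderAt f z ≠ ⊤) :
    ∃ v : ℂ → ℂ, AnalyticAt ℂ v z ∧ v z ≠ 0 ∧ ∀ᶠ w in 𝓝 z, P w = v w * f w := by
  obtain ⟨k, hk⟩ := ENat.ne_top_iff_exists.1 htop
  obtain ⟨a, ha, ha0, hPa⟩ := hP.analyticOrderAt_eq_natCast.1 (hord.trans hk.symm)
  obtain ⟨b, hb, hb0, hfb⟩ := hf.analyticOrderAt_eq_natCast.1 hk.symm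
  refine ⟨fun w => a w / b w, ha.div hb hb0, div_ne_zero ha0 hb0, ?_⟩
  filter_upwards [hPa, hfb, hb.continuousAt.eventually_ne hb0] with w h1 h2 h3
  rw [h1, h2, smul_eq_mul, smul_eq_mul]
  field_simp

lemma AnalyticAt.eventually_nhdsNE_ne_zero {f : ℂ → ℂ} {z : ℂ} (hf : AnalyticAt ℂ f z)
    (htop : analyticOrderAt f z ≠ ⊤) : ∀ᶠ w in 𝓝[≠] z, f w ≠ 0 :=
  hf.eventually_eq_zero_or_eventually_ne_zero.resolve_left
    fun h => htop (analyticOrderAt_eq_top.2 h)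

/-- Entire functions with the same zeros, counted with multiplicity, differ by an entire factor
without zeros. -/
lemma exists_differentiable_eq_mul {P f : ℂ → ℂ} (hP : Differentiable ℂ P)
    (hf : Differentiable ℂ f) (hord : ∀ z, analyticOrderAt P z = analyticOrderAt f z)
    (htop : ∀ z, analyticOrderAt f z ≠ ⊤) :
    ∃ u : ℂ → ℂ, Differentiable ℂ u ∧ (∀ z, u z ≠ 0) ∧ ∀ z, P z = u z * f z := by
  choose v hv hv0 hPv using fun z =>
    (hP.analyticAt z).exists_eventuallyEq_mul_of_analyticOrderAt_eq (hf.analyticAt z) (hord z)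
      (htop z)
  refine ⟨fun z => v z z, fun z => ?_, hv0, fun z => (hPv z).self_of_nhds⟩
  -- Near `z` and away from it, `f` has no zeros, so both sides equal P / f.
  have hev : (fun w => v w w) =ᶠ[𝓝 z] v z := by
    have h := eventually_nhdsWithin_iff.1 ((hf.analyticAt z).eventually_nhdsNE_ne_zero (htop z))
    filter_upwards [h, hPv z] with w hw hPw
    by_cases hwz : w = z
    · rw [hwz]
    · exact mul_right_cancel₀ (hw hwz) ((hPv w).self_of_nhds.symm.trans hPw)
  exact ((hv z).differentiableAt).congr_of_eventuallyEq hev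

section existence

variable {n : ℕ} {f : ℂ → ℙ ℂ (Fin (n + 1) → ℂ)}

lemma Projectivization.mk_rep_apply_eq_zero_iff {ι : Type*} {v : ι → ℂ} (hv : v ≠ 0) (i : ι) :
    (Projectivization.mk ℂ v hv).rep i = 0 ↔ v i = 0 := by
  obtain ⟨a, ha⟩ := Projectivization.exists_smul_eq_mk_rep ℂ v hv
  rw [← ha]
  simp [Units.smul_def]

/-- A homogeneous coordinate of a holomorphic curve that is nonzero at one point does not vanish
identically near any point. -/
lemma not_eventually_rep_eq_zero {G : ℂ → ℂ → Fin (n + 1) → ℂ} (hG : ∀ z, AnalyticAt ℂ (G z) z)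
    (hGf : ∀ z, ∀ᶠ w in 𝓝 z, ∃ hw : G z w ≠ 0, f w = Projectivization.mk ℂ (G z w) hw)
    {i : Fin (n + 1)} (hi : (f 0).rep i ≠ 0) (z : ℂ) : ¬ ∀ᶠ w in 𝓝 z, (f w).rep i = 0 := by
  -- `Z` is open and closed and misses 0, hence is empty because ℂ is connected.
  set Z : Set ℂ := {z | ∀ᶠ w in 𝓝 z, (f w).rep i = 0} with hZ
  have hopen : IsOpen Z := isOpen_iff_eventually.2 fun z hz => hz.eventually_nhds
  have hclosed : IsClosed Z := by
    refine isClosed_iff_frequently.2 fun z hz => ?_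
    have hGi : AnalyticAt ℂ (fun w => G z w i) z := (analyticAt_pi_iff.1 (hG z)) i
    have hrep : ∀ᶠ w in 𝓝 z, ((f w).rep i = 0 ↔ G z w i = 0) := by
      filter_upwards [hGf z] with w ⟨hw, hfw⟩
      rw [hfw, Projectivization.mk_rep_apply_eq_zero_iff]
    rcases hGi.eventually_eq_zero_or_eventually_ne_zero with h | h
    · show ∀ᶠ w in 𝓝 z, (f w).rep i = 0
      filter_upwards [h, hrep] with w h1 h2 using h2.2 h1
    · exfalso
      obtain ⟨w, hw, hZw⟩ := ((eventually_eventually_nhds.2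
        ((eventually_nhdsWithin_iff.1 h).and hrep)).and_frequently hz).exists
      have h1 : ∀ᶠ x in 𝓝[≠] w, x ≠ z := by
        by_cases hwz : w = z
        · rw [hwz]; exact self_mem_nhdsWithin
        · exact mem_nhdsWithin_of_mem_nhds (isOpen_ne.mem_nhds hwz)
      obtain ⟨x, hx1, ⟨hx2, hx3⟩, hx4⟩ :=
        (h1.and ((hw.and hZw).filter_mono nhdsWithin_le_nhds)).exists
      exact hx2 hx1 (hx3.1 hx4)
  have hne : Z ≠ Set.univ := by
    intro h
    have h0 : (0 : ℂ) ∈ Z := h ▸ Set.mem_univ _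
    exact hi (Eventually.self_of_nhds (p := fun w => (f w).rep i = 0) h0)
  have hempty : Z = ∅ := (isClopen_iff.1 ⟨hclosed, hopen⟩).resolve_right hne
  intro h
  exact Set.notMem_empty z (hempty ▸ h)

/-- Every holomorphic curve has a reduced representation. -/
theorem IsHolomorphicCurve.exists_isReducedRepresentation (hf : IsHolomorphicCurve f) :
    ∃ g, IsReducedRepresentation f g := by
  choose G hG hGf using hf
  obtain ⟨i, hi⟩ := Function.ne_iff.1 (f 0).rep_nonzero
  have hGi (z : ℂ) : AnalyticAt ℂ (fun w => G z w i) z := (analyticAt_pi_iff.1 (hG z)) i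
  have htop (z : ℂ) : analyticOrderAt (fun w => G z w i) z ≠ ⊤ := by
    intro h
    refine not_eventually_rep_eq_zero hG hGf hi z ?_
    filter_upwards [analyticOrderAt_eq_top.1 h, hGf z] with w h1 ⟨hw, hfw⟩
    rwa [hfw, Projectivization.mk_rep_apply_eq_zero_iff]
  have hne (z : ℂ) : ∀ᶠ w in 𝓝[≠] z, G z w i ≠ 0 := (hGi z).eventually_nhdsNE_ne_zero (htop z)
  have hcomp (z : ℂ) : ∀ᶠ w in 𝓝 z, ∃ a : ℂˣ, a • G z w = G w w := by
    filter_upwards [hGf z] with w ⟨hw, hfw⟩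
    obtain ⟨hw', hfw'⟩ := (hGf w).self_of_nhds
    exact (Projectivization.mk_eq_mk_iff ℂ _ _ hw' hw).1 (hfw'.symm.trans hfw)
  -- `P` will be the global i-th coordinate: each local representation is rescaled by a unit so that
  -- its i-th coordinate becomes `P`.
  obtain ⟨P, hP, hord⟩ := exists_differentiable_analyticOrderAt_eq
    (m := fun z => analyticOrderNatAt (fun w => G z w i) z)
    (finite_norm_le_ne_zero_of_eventually fun z => by
      filter_upwards [hne z, (hcomp z).filter_mono nhdsWithin_le_nhds] with w h1 ⟨a, ha⟩
      have h2 : G w w i ≠ 0 := by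
        rw [← ha, Pi.smul_apply, Units.smul_def]
        exact mul_ne_zero a.ne_zero h1
      by_contra h
      exact h2 (apply_eq_zero_of_analyticOrderNatAt_ne_zero (f := fun x => G w x i) h))
  choose v hv hv0 hPv using fun z =>
    (hP.analyticAt z).exists_eventuallyEq_mul_of_analyticOrderAt_eq (hGi z)
      ((hord z).trans (Nat.cast_analyticOrderNatAt (htop z))) (htop z)
  -- Two local representations differ at `w` by a scalar, which the i-th coordinate determines
  -- wherever it is nonzero.
  have hev (z : ℂ) : (fun w => v w w • G w w) =ᶠ[𝓝 z] fun w => v z w • G z w := by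
    filter_upwards [eventually_nhdsWithin_iff.1 (hne z), hPv z, hcomp z] with w hw hPw ⟨a, ha⟩
    by_cases hwz : w = z
    · rw [hwz]
    · have h1 : v w w * (a * G z w i) = v z w * G z w i := by
        rw [← hPw, (hPv w).self_of_nhds, ← ha]
        rfl
      have h2 : v w w * a = v z w := mul_right_cancel₀ (hw hwz) (by rw [mul_assoc, h1])
      rw [← ha, ← h2, mul_smul]
      rfl
  refine ⟨fun w => v w w • G w w, fun j z => ?_, fun z => ?_⟩
  · have h1 : AnalyticAt ℂ (fun w => v z w • G z w) z := (hv z).smul (hG z)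
    exact (differentiableAt_pi.1
      (h1.differentiableAt.congr_of_eventuallyEq (hev z))) j
  · obtain ⟨hw, hfw⟩ := (hGf z).self_of_nhds
    refine ⟨smul_ne_zero (hv0 z) hw, hfw.trans ?_⟩
    exact (Projectivization.mk_eq_mk_iff' ℂ _ _ _ _).2
      ⟨(v z z)⁻¹, by rw [smul_smul, inv_mul_cancel₀ (hv0 z), one_smul]⟩

end existence

/-! ### Circle averages of entire functions -/

/-- The zeros of `F` are discrete and do not affect the averages. They must be excluded because
`Real.log 0 = 0` can break the pointwise inequality there. -/
lemma circleAverage_mono_of_ne_zero {F : ℂ → ℂ} {φ ψ : ℂ → ℝ} {r : ℝ} (hr : r ≠ 0)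
    (hF : Differentiable ℂ F) (htop : ∀ z, analyticOrderAt F z ≠ ⊤)
    (hφ : CircleIntegrable φ 0 r) (hψ : CircleIntegrable ψ 0 r)
    (h : ∀ z, F z ≠ 0 → φ z ≤ ψ z) :
    Real.circleAverage φ 0 r ≤ Real.circleAverage ψ 0 r := by
  classical
  have hcod : {z | F z ≠ 0} ∈ codiscreteWithin (Metric.sphere (0 : ℂ) |r|) := by
    refine codiscreteWithin_mono (Set.subset_univ _) ?_
    change {z | F z ≠ 0} ∈ codiscrete ℂ
    exact mem_codiscrete.2 fun z => by
      rw [disjoint_principal_right, compl_compl]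
      exact (hF.analyticAt z).eventually_nhdsNE_ne_zero (htop z)
  have heq : φ =ᶠ[codiscreteWithin (Metric.sphere (0 : ℂ) |r|)]
      fun z => if F z = 0 then ψ z else φ z := by
    filter_upwards [hcod] with z hz
    exact (if_neg hz).symm
  rw [Real.circleAverage_congr_codiscreteWithin heq hr]
  refine Real.circleAverage_mono (hφ.congr_codiscreteWithin heq) hψ fun z _ => ?_
  split_ifs with h0
  · exact le_rfl
  · exact h z h0

lemma Differentiable.circleIntegrable_log_norm {F : ℂ → ℂ} (hF : Differentiable ℂ F) (r : ℝ) :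
    CircleIntegrable (fun z => Real.log ‖F z‖) 0 r :=
  MeromorphicOn.circleIntegrable_log_norm fun z _ => (hF.analyticAt z).meromorphicAt

lemma Differentiable.circleIntegrable_posLog_norm {F : ℂ → ℂ} (hF : Differentiable ℂ F) (r : ℝ) :
    CircleIntegrable (fun z => Real.posLog ‖F z‖) 0 r :=
  MeromorphicOn.circleIntegrable_posLog_norm fun z _ => (hF.analyticAt z).meromorphicAt

/-- Jensen's formula; zeros outside the disc contribute nothing because log⁺ vanishes there. -/
lemma sum_analyticOrderNatAt_mul_posLog_le {F : ℂ → ℂ} (hF : Differentiable ℂ F)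
    (h0 : F 0 ≠ 0) {r : ℝ} (hr : 0 < r) (s : Finset ℂ) :
    ∑ z ∈ s, analyticOrderNatAt F z * Real.posLog (r / ‖z‖) ≤
      Real.circleAverage (fun z => Real.log ‖F z‖) 0 r - Real.log ‖F 0‖ := by
  classical
  have hFan : AnalyticOnNhd ℂ F (Metric.closedBall 0 |r|) := fun z _ => hF.analyticAt z
  rw [AnalyticOnNhd.circleAverage_log_norm hr.ne' hFan h0, add_sub_cancel_right]
  set D := MeromorphicOn.divisor F (Metric.closedBall 0 |r|) with hD
  have hterm (z : ℂ) : (D z : ℝ) * Real.log (r * ‖0 - z‖⁻¹) =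
      analyticOrderNatAt F z * Real.posLog (r / ‖z‖) := by
    rw [zero_sub, norm_neg, ← div_eq_mul_inv]
    rcases eq_or_ne z 0 with rfl | hz0
    · simp
    have hz : 0 < ‖z‖ := norm_pos_iff.2 hz0
    by_cases hzr : ‖z‖ ≤ r
    · rw [hD, MeromorphicOn.AnalyticOnNhd.divisor_apply hFan (by simpa [abs_of_pos hr] using hzr), Real.posLog,
        max_eq_right (Real.log_nonneg ((one_le_div hz).2 hzr))]
      cases h : analyticOrderAt F z <;> simp [analyticOrderNatAt, h]
    · have h1 : D z = 0 := D.apply_eq_zero_of_notMem (by simpa [abs_of_pos hr] using hzr)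
      rw [h1, Real.posLog_eq_zero_iff _ |>.2]
      · simp
      · rw [abs_of_pos (by positivity), div_le_one hz]
        exact (not_le.1 hzr).le
  have hfin := D.finiteSupport (isCompact_closedBall 0 |r|)
  have hsub : (Function.support fun z => (D z : ℝ) * Real.log (r * ‖0 - z‖⁻¹)) ⊆
      ↑(s ∪ hfin.toFinset) := by
    intro z hz
    have : D z ≠ 0 := fun h => hz (by simp [h])
    simp [this]
  rw [finsum_eq_sum_of_support_subset _ hsub]
  simp_rw [hterm]
  exact Finset.sum_le_sum_of_subset_of_nonneg Finset.subset_union_left fun z _ _ =>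
    mul_nonneg (Nat.cast_nonneg _) Real.posLog_nonneg

lemma Differentiable.characteristic_top {F : ℂ → ℂ} (hF : Differentiable ℂ F) (r : ℝ) :
    ValueDistribution.characteristic F ⊤ r =
      Real.circleAverage (fun z => Real.posLog ‖F z‖) 0 r := by
  have h : ValueDistribution.logCounting F ⊤ = 0 := by
    have := ValueDistribution.logCounting_add_analyticOn (f := fun _ : ℂ => (0 : ℂ))
      (fun z => MeromorphicAt.const 0 z) (fun z _ => (hF.analyticAt z).analyticWithinAt)
    simpa [← Pi.zero_def] using this
  rw [ValueDistribution.characteristic, h, add_zero, ValueDistribution.proximity_top]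

lemma analyticOrderAt_ne_top_of_ne_zero {F : ℂ → ℂ} (hF : Differentiable ℂ F) (h0 : F 0 ≠ 0)
    (z : ℂ) : analyticOrderAt F z ≠ ⊤ := by
  intro h
  have hFan : AnalyticOnNhd ℂ F Set.univ := fun z _ => hF.analyticAt z
  have := AnalyticOnNhd.eqOn_zero_of_preconnected_of_eventuallyEq_zero hFan isPreconnected_univ (Set.mem_univ z) (analyticOrderAt_eq_top.1 h)
  exact h0 (this (Set.mem_univ 0))

/-! ### Components of a reduced representation and the characteristic of the curve. -/

section curve

variable {n : ℕ} {f : ℂ → ℙ ℂ (Fin (n + 1) → ℂ)} {g : ℂ → Fin (n + 1) → ℂ}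

lemma IsReducedRepresentation.continuous_log_norm (hg : IsReducedRepresentation f g) :
    Continuous fun z => Real.log ‖g z‖ := by
  have : Continuous g := continuous_pi fun i => (hg.1 i).continuous
  exact this.norm.log fun z => norm_ne_zero_iff.2 (hg.2 z).1

lemma IsReducedRepresentation.smul (hg : IsReducedRepresentation f g) {u : ℂ → ℂ}
    (hu : Differentiable ℂ u) (hu0 : ∀ z, u z ≠ 0) :
    IsReducedRepresentation f fun z => u z • g z := by
  refine ⟨fun i => hu.mul (hg.1 i), fun z => ?_⟩
  obtain ⟨hz, hfz⟩ := hg.2 z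
  exact ⟨smul_ne_zero (hu0 z) hz, hfz.trans ((Projectivization.mk_eq_mk_iff' ℂ _ _ _ _).2
    ⟨(u z)⁻¹, by rw [smul_smul, inv_mul_cancel₀ (hu0 z), one_smul]⟩)⟩

/-- As `u` has no zeros, log‖u‖ is harmonic and its circle mean is its value at the centre. -/
lemma IsReducedRepresentation.cartanMean_smul (hg : IsReducedRepresentation f g) {u : ℂ → ℂ}
    (hu : Differentiable ℂ u) (hu0 : ∀ z, u z ≠ 0) (r : ℝ) :
    cartanMean (fun z => u z • g z) r = Real.log ‖u 0‖ + cartanMean g r := by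
  have h1 : Real.circleAverage (fun z => Real.log ‖u z‖) 0 r = Real.log ‖u 0‖ :=
    AnalyticOnNhd.circleAverage_log_norm_of_ne_zero (fun z _ => hu.analyticAt z) fun z _ => hu0 z
  rw [cartanMean, cartanMean, ← h1, ← Real.circleAverage_fun_add (hu.circleIntegrable_log_norm r)
    hg.continuous_log_norm.continuousOn.circleIntegrable']
  congr 1
  ext z
  rw [norm_smul, Real.log_mul (norm_ne_zero_iff.2 (hu0 z)) (norm_ne_zero_iff.2 (hg.2 z).1)]

lemma IsReducedRepresentation.circleAverage_log_norm_apply_le (hg : IsReducedRepresentation f g)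
    {i : Fin (n + 1)} (h0 : g 0 i ≠ 0) {r : ℝ} (hr : r ≠ 0) :
    Real.circleAverage (fun z => Real.log ‖g z i‖) 0 r ≤ cartanMean g r :=
  circleAverage_mono_of_ne_zero hr (hg.1 i) (analyticOrderAt_ne_top_of_ne_zero (hg.1 i) h0)
    ((hg.1 i).circleIntegrable_log_norm r)
    hg.continuous_log_norm.continuousOn.circleIntegrable'
    fun z hz => Real.log_le_log (norm_pos_iff.2 hz) (norm_le_pi_norm (g z) i)

/-- The characteristic of every component is controlled by that of the curve and by the maximum
modulus of one component that does not vanish at the origin. -/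
lemma IsReducedRepresentation.characteristic_apply_le (hg : IsReducedRepresentation f g)
    {i : Fin (n + 1)} (h0 : g 0 i ≠ 0) {r B : ℝ} (hr : 0 < r) (hB : 0 ≤ B)
    (hgB : ∀ z, ‖z‖ = r → ‖g z i‖ ≤ Real.exp B) (j : Fin (n + 1)) :
    ValueDistribution.characteristic (fun z => g z j) ⊤ r ≤
      cartanMean g r + B - Real.log ‖g 0 i‖ := by
  have hI1 := hg.continuous_log_norm.continuousOn.circleIntegrable' (c := 0) (R := r)
  have hI2 := (hg.1 i).circleIntegrable_posLog_norm r
  have hI3 := (hg.1 i).circleIntegrable_log_norm r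
  have hmain : Real.circleAverage (fun z => Real.posLog ‖g z j‖) 0 r ≤
      Real.circleAverage ((fun z => Real.log ‖g z‖) + (fun z => Real.posLog ‖g z i‖) -
        fun z => Real.log ‖g z i‖) 0 r := by
    refine circleAverage_mono_of_ne_zero hr.ne' (hg.1 i)
      (analyticOrderAt_ne_top_of_ne_zero (hg.1 i) h0) ((hg.1 j).circleIntegrable_posLog_norm r)
      ((hI1.add hI2).sub hI3) fun z hz => ?_
    have h1 : Real.posLog ‖g z j‖ ≤ Real.posLog ‖g z‖ :=
      Real.posLog_le_posLog (norm_nonneg _) (norm_le_pi_norm (g z) j)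
    have h2 : Real.log ‖g z i‖ ≤ Real.log ‖g z‖ :=
      Real.log_le_log (norm_pos_iff.2 hz) (norm_le_pi_norm (g z) i)
    -- x⁺ - x = (-x)⁺ is decreasing in x.
    have h3 : Real.posLog ‖g z‖ - Real.log ‖g z‖ ≤ Real.posLog ‖g z i‖ - Real.log ‖g z i‖ := by
      simp only [Real.posLog]
      rcases max_cases 0 (Real.log ‖g z‖) with h | h <;>
        rcases max_cases 0 (Real.log ‖g z i‖) with h' | h' <;> linarith [h.1, h'.1, h.2, h'.2]
    simp only [Pi.sub_apply, Pi.add_apply]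
    linarith
  rw [Real.circleAverage_sub (hI1.add hI2) hI3, Real.circleAverage_add hI1 hI2] at hmain
  have hP : Real.circleAverage (fun z => Real.posLog ‖g z i‖) 0 r ≤ B := by
    refine Real.circleAverage_mono_on_of_le_circle hI2 fun z hz => max_le hB ?_
    rw [mem_sphere_zero_iff_norm, abs_of_pos hr] at hz
    rcases eq_or_ne (g z i) 0 with h | h
    · simpa [h] using hB
    · exact (Real.log_le_iff_le_exp (norm_pos_iff.2 h)).2 (hgB z hz)
  -- The empty set of zeros leaves Jensen's inequality log‖g_i(0)‖ ≤ mean of log‖g_i‖.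
  have hJ := sum_analyticOrderNatAt_mul_posLog_le (hg.1 i) h0 hr ∅
  rw [Finset.sum_empty] at hJ
  rw [(hg.1 j).characteristic_top]
  unfold cartanMean
  linarith

end curve

/-! ### Replacing a component by a genus zero product, and the theorem. -/

/-- An entire function whose zeros have a counting function dominated by `exp ((log r) ^ ρ)` has
the same zeros as a genus zero product of comparable growth. -/
theorem exists_genus_zero_product {F : ℂ → ℂ} (hF : Differentiable ℂ F) (h0 : F 0 ≠ 0)
    {ρ C R₀ : ℝ} (hρ0 : 0 ≤ ρ) (hρ1 : ρ < 1) (hR₀ : 1 ≤ R₀)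
    (hN : ∀ r, R₀ ≤ r → ∀ s : Finset ℂ,
      ∑ z ∈ s, analyticOrderNatAt F z * Real.posLog (r / ‖z‖) ≤ C * expLogPow ρ r) :
    ∃ (P : ℂ → ℂ) (K : ℝ), Differentiable ℂ P ∧
      (∀ z, analyticOrderAt P z = analyticOrderAt F z) ∧ 0 ≤ K ∧
      ∀ w, R₀ ≤ ‖w‖ → ‖P w‖ ≤ Real.exp (K * expLogPow ρ ‖w‖) := by
  have htop := analyticOrderAt_ne_top_of_ne_zero hF h0
  have hA (r : ℝ) : 0 < expLogPow ρ r := Real.exp_pos _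
  have hC : 0 ≤ C := by
    have := hN R₀ le_rfl ∅
    rw [Finset.sum_empty] at this
    exact nonneg_of_mul_nonneg_left this (hA R₀)
  set m : ℂ → ℕ := analyticOrderNatAt F with hm
  set K := 4 / Real.log 2 * (C * ∑' k : ℕ, (1 / 2 : ℝ) ^ k * expLogPow ρ (2 ^ k)) with hK
  have hsumb := summable_expLogPow_two_pow hρ1
  have hbound (r : ℝ) (hr : R₀ ≤ r) (s : Finset ℂ) :
      ∑ z ∈ s, m z * Real.log (1 + r / ‖z‖) ≤ K * expLogPow ρ r := by
    refine (sum_mul_log_one_add_le (A := C * expLogPow ρ r) r (by linarith) hsumb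
      (fun k s => ?_) s).trans_eq (by rw [hK]; ring)
    have h2k : (1 : ℝ) ≤ 2 ^ k := one_le_pow₀ one_le_two
    have hr1 : 1 ≤ r := hR₀.trans hr
    calc _ ≤ C * expLogPow ρ (2 ^ k * r) :=
          hN _ (hr.trans (le_mul_of_one_le_left (by linarith) h2k)) s
      _ ≤ C * (expLogPow ρ (2 ^ k) * expLogPow ρ r) := by
          gcongr; exact expLogPow_mul_le hρ0 hρ1.le h2k hr1
      _ = _ := by ring
  have hfin : ∀ R : ℝ, {z | ‖z‖ ≤ R ∧ m z ≠ 0}.Finite :=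
    finite_norm_le_ne_zero_of_eventually fun z => by
      filter_upwards [(hF.analyticAt z).eventually_nhdsNE_ne_zero (htop z)] with w hw
      by_contra h
      exact hw (apply_eq_zero_of_analyticOrderNatAt_ne_zero h)
  have hlog_nonneg (z : ℂ) : 0 ≤ m z * Real.log (1 + R₀ / ‖z‖) :=
    mul_nonneg (Nat.cast_nonneg _) (Real.log_nonneg (by
      have : 0 ≤ R₀ / ‖z‖ := by positivity
      linarith))
  have hslog : Summable fun z : ℂ => m z * Real.log (1 + R₀ / ‖z‖) :=
    summable_of_sum_le hlog_nonneg (hbound R₀ le_rfl)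
  -- For ‖z‖ > R₀ ≥ 1 and x = R₀/‖z‖ ≤ 1 one has log(1 + x) ≥ x/(1 + x) ≥ x/2 ≥ 1/(2‖z‖).
  have hsum : Summable fun z : ℂ => m z / ‖z‖ := by
    refine (hslog.mul_left 2).of_norm_bounded_eventually ?_
    filter_upwards [(hfin R₀).compl_mem_cofinite] with z hz
    by_cases hmz : m z = 0
    · simp [hmz]
    have hzR : R₀ < ‖z‖ := by
      by_contra! h
      exact hz ⟨h, hmz⟩
    have hz0 : 0 < ‖z‖ := by linarith
    have hx1 : R₀ / ‖z‖ ≤ 1 := (div_le_one hz0).2 hzR.le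
    have hx0 : 0 < R₀ / ‖z‖ := by positivity
    have h1 := Real.one_sub_inv_le_log_of_pos (show 0 < 1 + R₀ / ‖z‖ by positivity)
    have h2 : R₀ / ‖z‖ / 2 ≤ 1 - (1 + R₀ / ‖z‖)⁻¹ := by
      rw [show 1 - (1 + R₀ / ‖z‖)⁻¹ = R₀ / ‖z‖ / (1 + R₀ / ‖z‖) by field_simp; ring]
      gcongr
      linarith
    have h3 : 1 / ‖z‖ ≤ R₀ / ‖z‖ := by gcongr
    rw [Real.norm_of_nonneg (by positivity)]
    calc (m z : ℝ) / ‖z‖ = m z * (1 / ‖z‖) := by ring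
      _ ≤ m z * (2 * Real.log (1 + R₀ / ‖z‖)) := by gcongr; linarith
      _ = _ := by ring
  obtain ⟨P, hP, hord, hPb⟩ := exists_differentiable_analyticOrderAt_eq_norm_le (m := m)
    (by
      by_contra h
      exact h0 (apply_eq_zero_of_analyticOrderNatAt_ne_zero h)) hfin hsum
  refine ⟨P, K, hP, fun z => (hord z).trans (Nat.cast_analyticOrderNatAt (htop z)), ?_,
    fun w hw => hPb w _ (hbound ‖w‖ hw)⟩
  have := hbound R₀ le_rfl ∅
  rw [Finset.sum_empty] at this
  exact nonneg_of_mul_nonneg_left this (hA R₀)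

theorem theorem3p5 (n : ℕ) (f : ℂ → ℙ ℂ (Fin (n + 1) → ℂ)) (hf : IsHolomorphicCurve f)
    (hT : logHyperOrder (curveCharacteristic f) < 1) :
    ∃ g : ℂ → Fin (n + 1) → ℂ, IsReducedRepresentation f g ∧
      ∀ i, logHyperOrderFun (fun z => g z i) < 1 := by
  have hex := hf.exists_isReducedRepresentation
  obtain ⟨g, hg, hgT⟩ : ∃ g, IsReducedRepresentation f g ∧ curveCharacteristic f = cartanMean g :=
    ⟨hex.choose, hex.choose_spec, by rw [curveCharacteristic, dif_pos hex]⟩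
  rw [hgT] at hT
  obtain ⟨ρ, hρ0, hρ1, hTρ⟩ := exists_eventually_le_expLogPow hT
  obtain ⟨R, hR⟩ := eventually_atTop.1 hTρ
  set R₀ := max R 1 with hR₀
  have hR₀1 : 1 ≤ R₀ := le_max_right _ _
  have hA {r : ℝ} (hr : R₀ ≤ r) : 1 ≤ expLogPow ρ r := one_le_expLogPow (hR₀1.trans hr)
  have hTA {r : ℝ} (hr : R₀ ≤ r) : cartanMean g r ≤ expLogPow ρ r :=
    hR r ((le_max_left _ _).trans hr)
  obtain ⟨i, hi⟩ := Function.ne_iff.1 (hg.2 0).1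
  rw [Pi.zero_apply] at hi
  obtain ⟨P, K, hP, hord, hK, hPb⟩ := exists_genus_zero_product (hg.1 i) hi hρ0.le hρ1 hR₀1
    -- The 1 accounts for T_f; the constant of Jensen's formula is absorbed because the comparison
    -- function is at least 1.
    (C := 1 + |Real.log ‖g 0 i‖|) fun r hr s => by
      have hr0 : 0 < r := by linarith
      have h1 := sum_analyticOrderNatAt_mul_posLog_le (hg.1 i) hi hr0 s
      have h2 := hg.circleAverage_log_norm_apply_le hi hr0.ne'
      have h3 := neg_le_abs (Real.log ‖g 0 i‖)
      have h4 := le_mul_of_one_le_right (abs_nonneg (Real.log ‖g 0 i‖)) (hA hr)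
      linarith [hTA hr]
  obtain ⟨u, hu, hu0, hPu⟩ := exists_differentiable_eq_mul hP (hg.1 i) hord
    (analyticOrderAt_ne_top_of_ne_zero (hg.1 i) hi)
  have hG := hg.smul hu hu0
  refine ⟨_, hG, fun j => ?_⟩
  have hGi (z : ℂ) : (u z • g z) i = P z := (hPu z).symm
  have hP0 : (u 0 • g 0) i ≠ 0 := mul_ne_zero (hu0 0) hi
  set c := Real.log ‖u 0‖ - Real.log ‖(u 0 • g 0) i‖ with hc
  refine logHyperOrder_lt_one_of_le (C := 1 + K + |c|) hρ0 hρ1 ?_ ?_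
  · filter_upwards [eventually_ge_atTop 1] with r hr
    exact ValueDistribution.characteristic_nonneg hr
  · filter_upwards [eventually_ge_atTop R₀] with r hr
    have hr0 : 0 < r := by linarith
    have h1 := hG.characteristic_apply_le hP0 hr0 (B := K * expLogPow ρ r)
      (mul_nonneg hK (Real.exp_pos _).le) (fun z hz => by
        rw [hGi, ← hz]
        exact hPb z (hz ▸ hr)) j
    rw [hg.cartanMean_smul hu hu0] at h1
    have h2 := le_mul_of_one_le_right (abs_nonneg c) (hA hr)
    linarith [hTA hr, le_abs_self c]
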